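/- **Setting.** Fix sets of atomic concepts $A$, atomic roles $r$ and individuals $a$. Concepts of $\mathcal{EL\tilde{O}}_\bot$ are given by $C,D ::= A\mid\top\mid\bot\mid C\sqcap D\mid\exists r.C\mid\tilde a$, where $\tilde a$ is the *defeasible nominal* of the individual $a$. Concepts of $\mathcal{ELO}_\bot$ are the same with classical nominals $\{a\}$ in place of $\tilde a$, and $\mathcal{EL}_\bot$ has neither. An interpretation $I$ has a non-empty domain $\Delta^I$, sets $A^I\subseteq\Delta^I$, relations $r^I\subseteq\Delta^I\times\Delta^I$, elements $a^I\in\Delta^I$ with $\{a\}^I=\{a^I\}$, and arbitrary (possibly empty) sets $\tilde a^I\subseteq\Delta^I$. The other constructors, and negation $\neg C$ (used only in the definition of rational closure), are interpreted as usual. An ontology $K=\langle\mathcal T,\mathcal D\rangle$ consists of a finite set $\mathcal T$ of inclusions $E\sqsubseteq F$ and a finite set $\mathcal D$ of defeasible inclusions $E\mathrel{|\!\sim}F$. A ranked interpretation $R$ is an interpretation with a relation $\prec^R$ on $\Delta^R$ for which there is $\mathrm{rk}:\Delta^R\to\mathbb N$ with $x\prec^R y\iff \mathrm{rk}(x)<\mathrm{rk}(y)$.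 It satisfies $E\sqsubseteq F$ if $E^R\subseteq F^R$, and $E\mathrel{|\!\sim}F$ if $\min_{\prec^R}(E^R)\subseteq F^R$. It is a ranked model of $K$ if it satisfies all axioms of $\mathcal T\cup\mathcal D$, and $K$ is *rank satisfiable* if it has a ranked model. A concept $C$ is exceptional w.r.t. $K$ if $C^R\cap\min_{\prec^R}(\Delta^R)=\emptyset$ for every ranked model $R$ of $K$. Put $K^0=K$, and obtain $K^{i+1}$ from $K^i$ by deleting from its defeasible part the axioms whose antecedent is not exceptional w.r.t. $K^i$. The rank $r_K(C)\in\mathbb N\cup\{\infty\}$ is the least $i$ such that $C$ is not exceptional w.r.t. $K^i$ ($\infty$ if there is none), and $r_K(E\mathrel{|\!\sim}F)=r_K(E)$. The axiom $E\mathrel{|\!\sim}F$ is in the rational closure (RC) of $K$ if $r_K(E\sqcap F)<r_K(E\sqcap\neg F)$ or $r_K(E)=\infty$. The axiom $C\sqsubseteq D$ is in the RC of $K$ if its translation $C\sqcap\neg D\mathrel{|\!\sim}\bot$ is, i.e. if $r_K(C\sqcap\neg D)=\infty$. For an $\mathcal{EL\tilde{O}}_\bot$ expression $X$ let $X_{\{\}}$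 be the result of replacing every $\tilde a$ by $\{a\}$. For an $\mathcal{ELO}_\bot$ expression $X$ let $N(X)$ be the result of replacing every $\{a\}$ by a new atomic concept $N_a$. An $\mathcal{ELO}_\bot$ concept is safe if nominals occur in it only in subconcepts $\exists r.\{a\}$, and n-safe if it is safe or a nominal. An $\mathcal{EL\tilde{O}}_\bot$ inclusion $C\sqsubseteq D$ or $C\mathrel{|\!\sim}D$ is safe if $C_{\{\}}$ is n-safe and $D_{\{\}}$ is safe, and an ontology is nominal safe if all its axioms are safe. For an ontology $K$ write $\mathcal D^{\sqsubseteq}_{\{\},\infty}=\{E\sqsubseteq F\mid E\mathrel{|\!\sim}F\in\mathcal D_{\{\}},\ r_{K_{\{\}}}(E\mathrel{|\!\sim}F)=\infty\}$, and let $\models$ denote classical entailment. **Statement.** Let $K=\langle\mathcal T,\mathcal D\rangle$ be a nominal safe $\mathcal{EL\tilde{O}}_\bot$ ontology and $C\sqsubseteq D$ a safe $\mathcal{EL\tilde{O}}_\bot$ inclusion. Consider (i) $C\sqsubseteq D$ is in the RC of $K$; (ii) $N(C_{\{\}}\sqsubseteq D_{\{\}})$ is in the RC of $N(K_{\{\}})$;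 (iii) $\mathcal T_{\{\}}\cup \mathcal D^{\sqsubseteq}_{\{\},\infty}\models C_{\{\}}\sqsubseteq D_{\{\}}$. Then (i) and (ii) are equivalent, and (i) implies (iii). If $K_{\{\}}$ is rank satisfiable (or, more generally, if $K_{\{\}}$ is rank satisfiable whenever $K$ is), then (i), (ii) and (iii) are equivalent. -/

import Mathlib

universe u

namespace RCNominals

/-- Concept expressions over atomic concepts `CN`, atomic roles `RN` and individuals `ON`, with
classical nominals `{a}` (`nom a`) and defeasible nominals (`dnom a`).  Negation belongs to the
ambient description logic in which ranks of concepts are computed; the languages of the EL family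
are carved out by the predicates below. -/
inductive Concept (CN RN ON : Type u) : Type u
  | atom (A : CN)
  | top
  | bot
  | inf (C D : Concept CN RN ON)
  | neg (C : Concept CN RN ON)
  | ex (r : RN) (C : Concept CN RN ON)
  | nom (a : ON)
  | dnom (a : ON)

/-- A classical inclusion axiom `C ⊑ D`. -/
structure GCI (CN RN ON : Type u) : Type u where
  lhs : Concept CN RN ON
  rhs : Concept CN RN ON

/-- A defeasible inclusion axiom: typically, an instance of `lhs` is an instance of `rhs`. -/
structure DGCI (CN RN ON : Type u) : Type u where
  lhs : Concept CN RN ON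
  rhs : Concept CN RN ON

/-- A knowledge base: a TBox and a DBox. -/
structure KB (CN RN ON : Type u) : Type u where
  tbox : Set (GCI CN RN ON)
  dbox : Set (DGCI CN RN ON)

variable {CN RN ON : Type u}

/-! ### Semantics -/

/-- An interpretation: classical nominals denote singletons `{ind a}`, defeasible nominals denote
arbitrary (possibly empty) subsets of the domain. -/
structure Interp (CN RN ON : Type u) : Type (u + 1) where
  dom : Type u
  dom_nonempty : Nonempty dom
  atom : CN → Set dom
  role : RN → dom → dom → Prop
  ind : ON → dom
  dnom : ON → Set dom

/-- The extension of a concept in an interpretation. -/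
def Interp.ext (I : Interp CN RN ON) : Concept CN RN ON → Set I.dom
  | .atom A => I.atom A
  | .top => Set.univ
  | .bot => ∅
  | .inf C D => I.ext C ∩ I.ext D
  | .neg C => (I.ext C)ᶜ
  | .ex r C => {o | ∃ o', I.role r o o' ∧ o' ∈ I.ext C}
  | .nom a => {I.ind a}
  | .dnom a => I.dnom a

def Interp.SatGCI (I : Interp CN RN ON) (α : GCI CN RN ON) : Prop :=
  I.ext α.lhs ⊆ I.ext α.rhs

/-- Classical entailment of an inclusion axiom by a TBox. -/
def Entails (T : Set (GCI CN RN ON)) (α : GCI CN RN ON) : Prop :=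
  ∀ I : Interp CN RN ON, (∀ β ∈ T, I.SatGCI β) → I.SatGCI α

/-- A ranked interpretation: an interpretation with a modular preference relation. -/
structure RankedInterp (CN RN ON : Type u) : Type (u + 1) extends Interp CN RN ON where
  prec : dom → dom → Prop
  modular : ∃ rk : dom → ℕ, ∀ o p, prec o p ↔ rk o < rk p

/-- The most typical elements of a set. -/
def RankedInterp.minimals (R : RankedInterp CN RN ON) (X : Set R.dom) : Set R.dom :=
  {x | x ∈ X ∧ ¬ ∃ y ∈ X, R.prec y x}

def RankedInterp.SatDGCI (R : RankedInterp CN RN ON) (δ : DGCI CN RN ON) : Prop :=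
  R.minimals (R.ext δ.lhs) ⊆ R.ext δ.rhs

/-- `R` is a ranked model of `K`. -/
def RankedInterp.IsModel (R : RankedInterp CN RN ON) (K : KB CN RN ON) : Prop :=
  (∀ α ∈ K.tbox, R.SatGCI α) ∧ ∀ δ ∈ K.dbox, R.SatDGCI δ

/-- `K` has a ranked model. -/
def KB.RankSatisfiable (K : KB CN RN ON) : Prop :=
  ∃ R : RankedInterp CN RN ON, R.IsModel K

/-! ### Rational closure -/

/-- `C` is exceptional with respect to `K`: in no ranked model of `K` is it satisfied by a most
typical element of the domain. -/
def KB.Exceptional (K : KB CN RN ON) (C : Concept CN RN ON) : Prop :=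
  ∀ R : RankedInterp CN RN ON, R.IsModel K → R.ext C ∩ R.minimals Set.univ = ∅

/-- The knowledge bases `K = K⁰, K¹, K², …` of the ranking procedure: the defeasible axioms whose
antecedent is not exceptional with respect to `Kⁱ` (those of rank `i`) are dropped from the DBox to
obtain `Kⁱ⁺¹`; the TBox never changes. -/
def KB.stage (K : KB CN RN ON) : ℕ → KB CN RN ON
  | 0 => K
  | i + 1 => ⟨K.tbox, {δ | δ ∈ (K.stage i).dbox ∧ (K.stage i).Exceptional δ.lhs}⟩

/-- The rank of a concept: the least `i` such that the concept is not exceptional with respect to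
`Kⁱ`, and `∞` if there is none. -/
noncomputable def KB.rank (K : KB CN RN ON) (C : Concept CN RN ON) : ℕ∞ :=
  sInf {n | ∃ i : ℕ, n = i ∧ ¬ (K.stage i).Exceptional C}

/-- The rank of a defeasible axiom is the rank of its antecedent. -/
noncomputable def KB.rankAxiom (K : KB CN RN ON) (δ : DGCI CN RN ON) : ℕ∞ :=
  K.rank δ.lhs

/-- The defeasible axiom `δ` is in the rational closure of `K`. -/
def KB.InRC (K : KB CN RN ON) (δ : DGCI CN RN ON) : Prop :=
  K.rank (.inf δ.lhs δ.rhs) < K.rank (.inf δ.lhs (.neg δ.rhs)) ∨ K.rank δ.lhs = ⊤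

/-- The classical axiom `C ⊑ D` is in the rational closure of `K`: its defeasible translation,
`C ⊓ ¬D` is typically `⊥`, is in the rational closure. -/
def KB.InRCStrict (K : KB CN RN ON) (α : GCI CN RN ON) : Prop :=
  K.InRC ⟨.inf α.lhs (.neg α.rhs), .bot⟩

/-- The axioms of the DBox that have infinite rank, read as classical inclusions. -/
def KB.infiniteStrict (K : KB CN RN ON) : Set (GCI CN RN ON) :=
  {α | ∃ δ ∈ K.dbox, K.rankAxiom δ = ⊤ ∧ α = ⟨δ.lhs, δ.rhs⟩}

/-! ### Replacing nominals -/

/-- Replace every defeasible nominal by the corresponding classical nominal. -/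
def Concept.toNom : Concept CN RN ON → Concept CN RN ON
  | .atom A => .atom A
  | .top => .top
  | .bot => .bot
  | .inf C D => .inf C.toNom D.toNom
  | .neg C => .neg C.toNom
  | .ex r C => .ex r C.toNom
  | .nom a => .nom a
  | .dnom a => .nom a

def GCI.toNom (α : GCI CN RN ON) : GCI CN RN ON := ⟨α.lhs.toNom, α.rhs.toNom⟩

def DGCI.toNom (δ : DGCI CN RN ON) : DGCI CN RN ON := ⟨δ.lhs.toNom, δ.rhs.toNom⟩

def KB.toNom (K : KB CN RN ON) : KB CN RN ON :=
  ⟨GCI.toNom '' K.tbox, DGCI.toNom '' K.dbox⟩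

/-- `N(·)`: replace every classical nominal `{a}` by a new atomic concept `N_a`.  The atomic
concepts of the enlarged vocabulary are the old ones, `Sum.inl A`, and the new ones,
`N_a = Sum.inr a`. -/
def Concept.N : Concept CN RN ON → Concept (CN ⊕ ON) RN ON
  | .atom A => .atom (Sum.inl A)
  | .top => .top
  | .bot => .bot
  | .inf C D => .inf C.N D.N
  | .neg C => .neg C.N
  | .ex r C => .ex r C.N
  | .nom a => .atom (Sum.inr a)
  | .dnom a => .dnom a

def GCI.N (α : GCI CN RN ON) : GCI (CN ⊕ ON) RN ON := ⟨α.lhs.N, α.rhs.N⟩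

def DGCI.N (δ : DGCI CN RN ON) : DGCI (CN ⊕ ON) RN ON := ⟨δ.lhs.N, δ.rhs.N⟩

def KB.N (K : KB CN RN ON) : KB (CN ⊕ ON) RN ON :=
  ⟨GCI.N '' K.tbox, DGCI.N '' K.dbox⟩

/-! ### The language with defeasible nominals and safeness -/

/-- `C` is a concept of EL with `⊥` and defeasible nominals. -/
def Concept.IsELDefeasible : Concept CN RN ON → Prop
  | .atom _ => True
  | .top => True
  | .bot => True
  | .inf C D => C.IsELDefeasible ∧ D.IsELDefeasible
  | .neg _ => False
  | .ex _ C => C.IsELDefeasible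
  | .nom _ => False
  | .dnom _ => True

/-- Classical nominals occur in `C` only in subconcepts of the form `∃r.{a}`. -/
def Concept.Safe : Concept CN RN ON → Prop
  | .atom _ => True
  | .top => True
  | .bot => True
  | .inf C D => C.Safe ∧ D.Safe
  | .neg C => C.Safe
  | .ex _ C => (∃ a, C = .nom a) ∨ C.Safe
  | .nom _ => False
  | .dnom _ => True

/-- Negatively safe: safe or a nominal. -/
def Concept.NSafe (C : Concept CN RN ON) : Prop :=
  C.Safe ∨ ∃ a, C = .nom a

/-- `C ⊑ D` is a safe inclusion of EL with `⊥` and defeasible nominals. -/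
def GCI.IsSafeDefeasible (α : GCI CN RN ON) : Prop :=
  α.lhs.IsELDefeasible ∧ α.rhs.IsELDefeasible ∧ α.lhs.toNom.NSafe ∧ α.rhs.toNom.Safe

/-- A safe defeasible inclusion of EL with `⊥` and defeasible nominals. -/
def DGCI.IsSafeDefeasible (δ : DGCI CN RN ON) : Prop :=
  δ.lhs.IsELDefeasible ∧ δ.rhs.IsELDefeasible ∧ δ.lhs.toNom.NSafe ∧ δ.rhs.toNom.Safe

/-- `K` is a nominal safe ontology of EL with `⊥` and defeasible nominals: finitely many axioms,
all of them safe. -/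
structure KB.IsNominalSafe (K : KB CN RN ON) : Prop where
  tbox_finite : K.tbox.Finite
  dbox_finite : K.dbox.Finite
  tbox_safe : ∀ α ∈ K.tbox, α.IsSafeDefeasible
  dbox_safe : ∀ δ ∈ K.dbox, δ.IsSafeDefeasible

end RCNominals

namespace RCNominals

variable {CN RN ON : Type u}

/-! ### Ranks and stages -/

/-! An inclusion is in the RC exactly when `C ⊓ ¬D` is exceptional at every stage. Without classical
nominals, `ã` is just another atomic concept, so models, exceptionality and stages agree for `K` and
`K.toNom.N`; this gives (i) ↔ (ii). A model of `K.toNom` is a model of `K` with singleton defeasible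
nominals, so exceptionality passes to `K.toNom`. A classical model of the TBox and the infinite-rank
axioms, given constant rank, is a ranked model of a late stage; this gives (i) → (iii).

For (iii) → (i), let `L` be the TBox of `K` with those defeasible axioms whose translation has
infinite rank. `KB.IsNominalSafe.exists_isModel_toNom` adds to a ranked model of `L` a disjoint
model in which no `ã` is empty, then takes the power of the union by its own domain. The tuple
listing all instances of `ã` serves as the individual `a`: a safe concept holds of it iff it holds
on all of `ã`. The result models `L.toNom` and reflects safe inclusions. There the antecedents of
`L` are empty (`RankedInterp.IsModel.ext_lhs_eq_empty`), hence also in every ranked model of `L`. So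
`L` survives every stage of `K`, and the entailed inclusion is reflected as well. If `K` has no
ranked model, everything is in its RC. -/

theorem KB.rank_eq_top_iff (K : KB CN RN ON) (C : Concept CN RN ON) :
    K.rank C = ⊤ ↔ ∀ i, (K.stage i).Exceptional C := by
  unfold KB.rank
  rw [sInf_eq_top]
  constructor
  · intro h i
    by_contra hi
    exact ENat.natCast_ne_top i (h i ⟨i, rfl, hi⟩)
  · rintro h _ ⟨i, -, hi⟩
    exact absurd (h i) hi

/-- The translated axiom has consequent `⊥`, so the left side of the strict rank inequality is `⊤`
and only the infinite-rank alternative remains. -/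
theorem KB.inRCStrict_iff (K : KB CN RN ON) (α : GCI CN RN ON) :
    K.InRCStrict α ↔ ∀ i, (K.stage i).Exceptional (.inf α.lhs (.neg α.rhs)) := by
  rw [← KB.rank_eq_top_iff]
  have h : K.rank (.inf (.inf α.lhs (.neg α.rhs)) .bot) = ⊤ := by
    rw [KB.rank_eq_top_iff]
    intro i R _
    simp [Interp.ext]
  simp [KB.InRCStrict, KB.InRC, h]

theorem KB.stage_tbox (K : KB CN RN ON) (i : ℕ) : (K.stage i).tbox = K.tbox := by
  cases i <;> rfl

theorem KB.stage_dbox_antitone (K : KB CN RN ON) : Antitone fun i => (K.stage i).dbox :=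
  antitone_nat_of_succ_le fun _ _ h => h.1

theorem KB.mem_stage_of_rankAxiom_eq_top {K : KB CN RN ON} {δ : DGCI CN RN ON}
    (hδ : δ ∈ K.dbox) (h : K.rankAxiom δ = ⊤) (i : ℕ) : δ ∈ (K.stage i).dbox := by
  induction i with
  | zero => exact hδ
  | succ i ih => exact ⟨ih, (K.rank_eq_top_iff _).1 h i⟩

/-- For a finite DBox the ranking procedure reaches the axioms of infinite rank. -/
theorem KB.exists_stage_dbox_eq (K : KB CN RN ON) (hK : K.dbox.Finite) :
    ∃ n, (K.stage n).dbox = {δ | δ ∈ K.dbox ∧ K.rankAxiom δ = ⊤} := by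
  have h : ∀ δ : DGCI CN RN ON, ∃ i, K.rankAxiom δ = ⊤ ∨ δ ∉ (K.stage i).dbox := by
    intro δ
    by_cases hδ : K.rankAxiom δ = ⊤
    · exact ⟨0, .inl hδ⟩
    · have := mt (K.rank_eq_top_iff _).2 hδ
      push Not at this
      obtain ⟨i, hi⟩ := this
      exact ⟨i + 1, .inr fun h => hi h.2⟩
  choose s hs using h
  obtain ⟨n, hn⟩ := (hK.image s).bddAbove
  refine ⟨n, Set.Subset.antisymm (fun δ hδ => ?_)
    fun δ hδ => mem_stage_of_rankAxiom_eq_top hδ.1 hδ.2 n⟩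
  have hδK : δ ∈ K.dbox := K.stage_dbox_antitone (Nat.zero_le n) hδ
  refine ⟨hδK, (hs δ).resolve_right fun h => h ?_⟩
  exact K.stage_dbox_antitone (hn ⟨δ, hδK, rfl⟩) hδ

theorem RankedInterp.IsModel.mono {R : RankedInterp CN RN ON} {K L : KB CN RN ON}
    (h : R.IsModel L) (ht : K.tbox ⊆ L.tbox) (hd : K.dbox ⊆ L.dbox) : R.IsModel K :=
  ⟨fun α hα => h.1 α (ht hα), fun δ hδ => h.2 δ (hd hδ)⟩

theorem RankedInterp.IsModel.stage {R : RankedInterp CN RN ON} {K : KB CN RN ON}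
    (h : R.IsModel K) (i : ℕ) : R.IsModel (K.stage i) :=
  h.mono (K.stage_tbox i).le (K.stage_dbox_antitone (Nat.zero_le i))

theorem KB.Exceptional.mono {K L : KB CN RN ON} {C : Concept CN RN ON} (h : K.Exceptional C)
    (ht : K.tbox ⊆ L.tbox) (hd : K.dbox ⊆ L.dbox) : L.Exceptional C :=
  fun R hR => h R (hR.mono ht hd)

/-- Equip an interpretation with the preference relation given by a rank function. -/
def Interp.withRank (I : Interp CN RN ON) (rk : I.dom → ℕ) : RankedInterp CN RN ON where
  toInterp := I
  prec o p := rk o < rk p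
  modular := ⟨rk, fun _ _ => Iff.rfl⟩

theorem RankedInterp.eq_withRank (R : RankedInterp CN RN ON) :
    ∃ rk : R.dom → ℕ, R = R.toInterp.withRank rk := by
  obtain ⟨I, prec, rk, h⟩ := R
  refine ⟨rk, ?_⟩
  have : prec = fun o p => rk o < rk p := by
    ext o p
    exact h o p
  subst this
  rfl

theorem Interp.mem_minimals_withRank {I : Interp CN RN ON} {rk : I.dom → ℕ} {X : Set I.dom}
    {x : I.dom} : x ∈ (I.withRank rk).minimals X ↔ x ∈ X ∧ ∀ y ∈ X, rk x ≤ rk y := by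
  change x ∈ X ∧ ¬ (∃ y ∈ X, rk y < rk x) ↔ _
  push Not
  rfl

/-- If every antecedent of the DBox is exceptional, the antecedents are empty in all ranked
models. -/
theorem RankedInterp.IsModel.ext_lhs_eq_empty {L : KB CN RN ON}
    (hL : ∀ δ ∈ L.dbox, L.Exceptional δ.lhs) {R : RankedInterp CN RN ON} (hR : R.IsModel L)
    {δ : DGCI CN RN ON} (hδ : δ ∈ L.dbox) : R.ext δ.lhs = ∅ := by
  obtain ⟨rk, hrk⟩ := R.eq_withRank
  generalize R.toInterp = I at rk hrk
  subst hrk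
  by_contra hne
  obtain ⟨x₀, hx₀⟩ := Set.nonempty_iff_ne_empty.2 hne
  let U : Set I.dom := {x | ∃ ε ∈ L.dbox, x ∈ I.ext ε.lhs}
  obtain ⟨y, ⟨ε, hε, hy⟩, hmin⟩ :=
    exists_minimalFor_of_wellFoundedLT (· ∈ U) rk ⟨x₀, δ, hδ, hx₀⟩
  have hmin' : ∀ z ∈ U, rk y ≤ rk z := fun z hz => by
    rcases le_total (rk y) (rk z) with h | h
    · exact h
    · exact hmin hz h
  -- Truncated subtraction collapses everything below `y` to rank 0. All antecedents lie at or above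
  -- `y`, so their minimal elements do not change, while `y` becomes minimal in the whole domain.
  have hM : (I.withRank fun z => rk z - rk y).IsModel L := by
    refine ⟨hR.1, fun ζ hζ x hx => hR.2 ζ hζ ?_⟩
    replace hx := Interp.mem_minimals_withRank.1 hx
    refine Interp.mem_minimals_withRank.2 ⟨hx.1, fun z hz => ?_⟩
    have h1 := hx.2 z hz
    have h2 := hmin' z ⟨ζ, hζ, hz⟩
    have h3 := hmin' x ⟨ζ, hζ, hx.1⟩
    omega
  have h := hL ε hε _ hM
  exact Set.eq_empty_iff_forall_notMem.1 h y
    ⟨hy, Interp.mem_minimals_withRank.2 ⟨trivial, fun z _ => by omega⟩⟩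

/-! ### Defeasible nominals as atomic concepts -/

/-- No classical nominal occurs in the concept. -/
def Concept.NomFree : Concept CN RN ON → Prop
  | .atom _ => True
  | .top => True
  | .bot => True
  | .inf C D => C.NomFree ∧ D.NomFree
  | .neg C => C.NomFree
  | .ex _ C => C.NomFree
  | .nom _ => False
  | .dnom _ => True

theorem Concept.IsELDefeasible.nomFree {C : Concept CN RN ON} (h : C.IsELDefeasible) :
    C.NomFree := by
  induction C with
  | inf C D ihC ihD => exact ⟨ihC h.1, ihD h.2⟩
  | ex r C ih => exact ih h
  | neg => exact h.elim
  | nom => exact h.elim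
  | _ => trivial

/-- Interpret the atomic concept `N_a` as the defeasible nominal of `a`. -/
def RankedInterp.nameNominals (R : RankedInterp CN RN ON) : RankedInterp (CN ⊕ ON) RN ON where
  dom := R.dom
  dom_nonempty := R.dom_nonempty
  atom := Sum.elim R.atom R.dnom
  role := R.role
  ind := R.ind
  dnom := R.dnom
  prec := R.prec
  modular := R.modular

/-- Interpret the defeasible nominal of `a` as the atomic concept `N_a`. -/
def RankedInterp.unnameNominals (R : RankedInterp (CN ⊕ ON) RN ON) : RankedInterp CN RN ON where
  dom := R.dom
  dom_nonempty := R.dom_nonempty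
  atom A := R.atom (.inl A)
  role := R.role
  ind := R.ind
  dnom a := R.atom (.inr a)
  prec := R.prec
  modular := R.modular

theorem RankedInterp.ext_nameNominals (R : RankedInterp CN RN ON) {C : Concept CN RN ON}
    (hC : C.NomFree) : R.nameNominals.ext C.toNom.N = R.ext C := by
  induction C with
  | inf C D ihC ihD => exact congrArg₂ (· ∩ ·) (ihC hC.1) (ihD hC.2)
  | ex r C ih => exact congrArg (fun X : Set R.dom => {o | ∃ o', R.role r o o' ∧ o' ∈ X}) (ih hC)
  | neg C ih => exact congrArg (fun X : Set R.dom => Xᶜ) (ih hC)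
  | nom => exact hC.elim
  | _ => rfl

theorem RankedInterp.ext_unnameNominals (R : RankedInterp (CN ⊕ ON) RN ON)
    {C : Concept CN RN ON} (hC : C.NomFree) : R.unnameNominals.ext C = R.ext C.toNom.N := by
  induction C with
  | inf C D ihC ihD => exact congrArg₂ (· ∩ ·) (ihC hC.1) (ihD hC.2)
  | ex r C ih => exact congrArg (fun X : Set R.dom => {o | ∃ o', R.role r o o' ∧ o' ∈ X}) (ih hC)
  | neg C ih => exact congrArg (fun X : Set R.dom => Xᶜ) (ih hC)
  | nom => exact hC.elim
  | _ => rfl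

/-- No classical nominal occurs in the knowledge base. -/
structure KB.NomFree (K : KB CN RN ON) : Prop where
  tbox : ∀ α ∈ K.tbox, α.lhs.NomFree ∧ α.rhs.NomFree
  dbox : ∀ δ ∈ K.dbox, δ.lhs.NomFree ∧ δ.rhs.NomFree

theorem KB.IsNominalSafe.nomFree {K : KB CN RN ON} (hK : K.IsNominalSafe) : K.NomFree :=
  ⟨fun α hα => ⟨(hK.tbox_safe α hα).1.nomFree, (hK.tbox_safe α hα).2.1.nomFree⟩,
    fun δ hδ => ⟨(hK.dbox_safe δ hδ).1.nomFree, (hK.dbox_safe δ hδ).2.1.nomFree⟩⟩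

theorem KB.NomFree.stage {K : KB CN RN ON} (hK : K.NomFree) (i : ℕ) : (K.stage i).NomFree :=
  ⟨fun α hα => hK.tbox α (K.stage_tbox i ▸ hα),
    fun δ hδ => hK.dbox δ (K.stage_dbox_antitone (Nat.zero_le i) hδ)⟩

theorem RankedInterp.IsModel.nameNominals {K : KB CN RN ON} (hK : K.NomFree)
    {R : RankedInterp CN RN ON} (hR : R.IsModel K) : R.nameNominals.IsModel K.toNom.N := by
  constructor
  · rintro _ ⟨_, ⟨α, hα, rfl⟩, rfl⟩
    change R.nameNominals.ext α.lhs.toNom.N ⊆ R.nameNominals.ext α.rhs.toNom.N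
    rw [R.ext_nameNominals (hK.tbox α hα).1, R.ext_nameNominals (hK.tbox α hα).2]
    exact hR.1 α hα
  · rintro _ ⟨_, ⟨δ, hδ, rfl⟩, rfl⟩
    change R.nameNominals.minimals (R.nameNominals.ext δ.lhs.toNom.N) ⊆
      R.nameNominals.ext δ.rhs.toNom.N
    rw [R.ext_nameNominals (hK.dbox δ hδ).1, R.ext_nameNominals (hK.dbox δ hδ).2]
    exact hR.2 δ hδ

theorem RankedInterp.IsModel.unnameNominals {K : KB CN RN ON} (hK : K.NomFree)
    {R : RankedInterp (CN ⊕ ON) RN ON} (hR : R.IsModel K.toNom.N) :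
    R.unnameNominals.IsModel K := by
  constructor
  · intro α hα
    unfold Interp.SatGCI
    rw [R.ext_unnameNominals (hK.tbox α hα).1, R.ext_unnameNominals (hK.tbox α hα).2]
    exact hR.1 _ ⟨_, ⟨α, hα, rfl⟩, rfl⟩
  · intro δ hδ
    unfold RankedInterp.SatDGCI
    rw [R.ext_unnameNominals (hK.dbox δ hδ).1, R.ext_unnameNominals (hK.dbox δ hδ).2]
    exact hR.2 _ ⟨_, ⟨δ, hδ, rfl⟩, rfl⟩

theorem KB.NomFree.exceptional_toNom_N_iff {K : KB CN RN ON} (hK : K.NomFree)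
    {C : Concept CN RN ON} (hC : C.NomFree) :
    K.toNom.N.Exceptional C.toNom.N ↔ K.Exceptional C := by
  constructor
  · intro h R hR
    have := h _ (hR.nameNominals hK)
    rw [R.ext_nameNominals hC] at this
    exact this
  · intro h R hR
    have := h _ (hR.unnameNominals hK)
    rw [R.ext_unnameNominals hC] at this
    exact this

theorem KB.NomFree.stage_toNom_N {K : KB CN RN ON} (hK : K.NomFree) (i : ℕ) :
    K.toNom.N.stage i = (K.stage i).toNom.N := by
  induction i with
  | zero => rfl
  | succ i ih =>
    unfold KB.stage
    rw [ih]
    refine congrArg₂ KB.mk rfl (Set.ext fun δ' => ⟨?_, ?_⟩)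
    · rintro ⟨⟨_, ⟨δ, hδ, rfl⟩, rfl⟩, h⟩
      exact ⟨_, ⟨δ, ⟨hδ, ((hK.stage i).exceptional_toNom_N_iff
        ((hK.stage i).dbox δ hδ).1).1 h⟩, rfl⟩, rfl⟩
    · rintro ⟨_, ⟨δ, ⟨hδ, h⟩, rfl⟩, rfl⟩
      exact ⟨⟨_, ⟨δ, hδ, rfl⟩, rfl⟩, ((hK.stage i).exceptional_toNom_N_iff
        ((hK.stage i).dbox δ hδ).1).2 h⟩

theorem KB.NomFree.inRCStrict_toNom_N_iff {K : KB CN RN ON} (hK : K.NomFree)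
    {α : GCI CN RN ON} (hl : α.lhs.NomFree) (hr : α.rhs.NomFree) :
    K.toNom.N.InRCStrict α.toNom.N ↔ K.InRCStrict α := by
  rw [KB.inRCStrict_iff, KB.inRCStrict_iff]
  refine forall_congr' fun i => ?_
  rw [hK.stage_toNom_N]
  exact (hK.stage i).exceptional_toNom_N_iff (C := .inf α.lhs (.neg α.rhs)) ⟨hl, hr⟩

/-! ### Defeasible nominals as singletons -/

/-- Interpret every defeasible nominal as the corresponding classical nominal. -/
def RankedInterp.dnomSingleton (R : RankedInterp CN RN ON) : RankedInterp CN RN ON :=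
  { R with dnom := fun a => {R.ind a} }

theorem RankedInterp.ext_dnomSingleton (R : RankedInterp CN RN ON) (C : Concept CN RN ON) :
    R.dnomSingleton.ext C = R.ext C.toNom := by
  induction C with
  | inf C D ihC ihD => exact congrArg₂ (· ∩ ·) ihC ihD
  | ex r C ih => exact congrArg (fun X : Set R.dom => {o | ∃ o', R.role r o o' ∧ o' ∈ X}) ih
  | neg C ih => exact congrArg (fun X : Set R.dom => Xᶜ) ih
  | _ => rfl

theorem RankedInterp.IsModel.dnomSingleton {K : KB CN RN ON} {R : RankedInterp CN RN ON}
    (hR : R.IsModel K.toNom) : R.dnomSingleton.IsModel K := by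
  constructor
  · intro α hα
    unfold Interp.SatGCI
    rw [R.ext_dnomSingleton, R.ext_dnomSingleton]
    exact hR.1 _ ⟨α, hα, rfl⟩
  · intro δ hδ
    unfold RankedInterp.SatDGCI
    rw [R.ext_dnomSingleton, R.ext_dnomSingleton]
    exact hR.2 _ ⟨δ, hδ, rfl⟩

theorem KB.Exceptional.toNom {K : KB CN RN ON} {C : Concept CN RN ON} (h : K.Exceptional C) :
    K.toNom.Exceptional C.toNom := by
  intro R hR
  have := h _ hR.dnomSingleton
  rw [R.ext_dnomSingleton] at this
  exact this

theorem KB.toNom_stage_dbox_subset (K : KB CN RN ON) (i : ℕ) :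
    (K.stage i).toNom.dbox ⊆ (K.toNom.stage i).dbox := by
  induction i with
  | zero => exact subset_rfl
  | succ i ih =>
    rintro _ ⟨δ, ⟨hδ, h⟩, rfl⟩
    refine ⟨ih ⟨δ, hδ, rfl⟩, h.toNom.mono ?_ ih⟩
    rw [KB.stage_tbox]
    exact (congrArg (GCI.toNom '' ·) (K.stage_tbox i)).le

/-- Nominals being read classically can only increase ranks. -/
theorem KB.exceptional_stage_toNom {K : KB CN RN ON} {C : Concept CN RN ON} {i : ℕ}
    (h : (K.stage i).Exceptional C) : (K.toNom.stage i).Exceptional C.toNom := by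
  refine h.toNom.mono ?_ (K.toNom_stage_dbox_subset i)
  rw [KB.stage_tbox]
  exact (congrArg (GCI.toNom '' ·) (K.stage_tbox i)).le

/-- Classical inclusions in the rational closure follow classically from the TBox and the axioms
of infinite rank. -/
theorem KB.entails_of_inRCStrict {K : KB CN RN ON} (hK : K.dbox.Finite) {α : GCI CN RN ON}
    (h : K.InRCStrict α) : Entails (K.tbox ∪ K.infiniteStrict) α := by
  intro I hI
  obtain ⟨n, hn⟩ := K.exists_stage_dbox_eq hK
  -- With constant rank every element is minimal, so defeasible axioms act as classical inclusions.
  have hM : (I.withRank fun _ => 0).IsModel (K.stage n) := by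
    constructor
    · intro β hβ
      exact hI β (.inl (K.stage_tbox n ▸ hβ))
    · intro δ hδ x hx
      rw [hn] at hδ
      exact hI ⟨δ.lhs, δ.rhs⟩ (.inr ⟨δ, hδ.1, hδ.2, rfl⟩) hx.1
  intro x hx
  by_contra hx'
  exact Set.eq_empty_iff_forall_notMem.1 ((K.inRCStrict_iff α).1 h n _ hM) x
    ⟨⟨hx, hx'⟩, Interp.mem_minimals_withRank.2 ⟨trivial, fun _ _ => le_rfl⟩⟩

theorem KB.InRCStrict.toNom {K : KB CN RN ON} {α : GCI CN RN ON} (h : K.InRCStrict α) :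
    K.toNom.InRCStrict α.toNom := by
  rw [KB.inRCStrict_iff] at h ⊢
  exact fun i => KB.exceptional_stage_toNom (h i)

/-! ### Disjoint unions -/

/-- The disjoint union of two interpretations. -/
def Interp.sum (I J : Interp CN RN ON) : Interp CN RN ON where
  dom := I.dom ⊕ J.dom
  dom_nonempty := I.dom_nonempty.map Sum.inl
  atom A := Sum.elim (I.atom A) (J.atom A)
  role r := Sum.LiftRel (I.role r) (J.role r)
  -- An arbitrary choice: only nominal-free concepts are evaluated in the union.
  ind a := .inl (I.ind a)
  dnom a := Sum.elim (I.dnom a) (J.dnom a)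

theorem Interp.mem_ext_sum (I J : Interp CN RN ON) {C : Concept CN RN ON} (hC : C.NomFree) :
    (∀ x, Sum.inl x ∈ (I.sum J).ext C ↔ x ∈ I.ext C) ∧
      ∀ y, Sum.inr y ∈ (I.sum J).ext C ↔ y ∈ J.ext C := by
  induction C with
  | atom => exact ⟨fun _ => Iff.rfl, fun _ => Iff.rfl⟩
  | top => exact ⟨fun _ => Iff.rfl, fun _ => Iff.rfl⟩
  | bot => exact ⟨fun _ => Iff.rfl, fun _ => Iff.rfl⟩
  | dnom => exact ⟨fun _ => Iff.rfl, fun _ => Iff.rfl⟩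
  | nom => exact hC.elim
  | inf C D ihC ihD =>
    exact ⟨fun x => and_congr ((ihC hC.1).1 x) ((ihD hC.2).1 x),
      fun y => and_congr ((ihC hC.1).2 y) ((ihD hC.2).2 y)⟩
  | neg C ih => exact ⟨fun x => not_congr ((ih hC).1 x), fun y => not_congr ((ih hC).2 y)⟩
  | ex r C ih =>
    obtain ⟨ihl, ihr⟩ := ih hC
    constructor
    · intro x
      constructor
      · rintro ⟨_, h | h, h'⟩
        exact ⟨_, h, (ihl _).1 h'⟩
      · rintro ⟨y, h, h'⟩
        exact ⟨.inl y, .inl h, (ihl _).2 h'⟩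
    · intro x
      constructor
      · rintro ⟨_, h | h, h'⟩
        exact ⟨_, h, (ihr _).1 h'⟩
      · rintro ⟨y, h, h'⟩
        exact ⟨.inr y, .inr h, (ihr _).2 h'⟩

/-- A minimal element of the union is minimal within its own summand, so the two rank functions need
no alignment. -/
theorem KB.NomFree.isModel_sum {K : KB CN RN ON} (hK : K.NomFree) {I J : Interp CN RN ON}
    {rk : I.dom → ℕ} {rk' : J.dom → ℕ} (hI : (I.withRank rk).IsModel K)
    (hJ : (J.withRank rk').IsModel K) :
    ((I.sum J).withRank (Sum.elim rk rk' : I.dom ⊕ J.dom → ℕ)).IsModel K := by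
  constructor
  · intro α hα
    have hl := I.mem_ext_sum J (hK.tbox α hα).1
    have hr := I.mem_ext_sum J (hK.tbox α hα).2
    rintro (x | x) hx
    · exact (hr.1 x).2 (hI.1 α hα ((hl.1 x).1 hx))
    · exact (hr.2 x).2 (hJ.1 α hα ((hl.2 x).1 hx))
  · intro δ hδ
    have hl := I.mem_ext_sum J (hK.dbox δ hδ).1
    have hr := I.mem_ext_sum J (hK.dbox δ hδ).2
    rintro (x | x) hx <;> replace hx := Interp.mem_minimals_withRank.1 hx
    · refine (hr.1 x).2 (hI.2 δ hδ (Interp.mem_minimals_withRank.2 ?_))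
      exact ⟨(hl.1 x).1 hx.1, fun y hy => hx.2 (.inl y) ((hl.1 y).2 hy)⟩
    · refine (hr.2 x).2 (hJ.2 δ hδ (Interp.mem_minimals_withRank.2 ?_))
      exact ⟨(hl.2 x).1 hx.1, fun y hy => hx.2 (.inr y) ((hl.2 y).2 hy)⟩

/-! ### A power with generic individuals -/

/-- A function whose range is the given non-empty set. -/
noncomputable def generic {X : Type u} {S : Set X} (hS : S.Nonempty) : X → X :=
  open Classical in fun x => if x ∈ S then x else hS.some

theorem generic_mem {X : Type u} {S : Set X} (hS : S.Nonempty) (x : X) : generic hS x ∈ S := by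
  unfold generic
  split_ifs with h
  exacts [h, hS.some_mem]

theorem generic_of_mem {X : Type u} {S : Set X} (hS : S.Nonempty) {x : X} (hx : x ∈ S) :
    generic hS x = x :=
  if_pos hx

/-- The power of an interpretation by its own domain, where the individual `a` denotes a tuple that
lists all instances of the defeasible nominal of `a`, and every instance of
`∃r.ã` gets an `r`-edge to that tuple. -/
noncomputable def Interp.genericPower (I : Interp CN RN ON) (hI : ∀ a, (I.dnom a).Nonempty) :
    Interp CN RN ON where
  dom := I.dom → I.dom
  dom_nonempty := ⟨id⟩
  atom A := {f | ∀ z, f z ∈ I.atom A}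
  -- Coordinatewise edges alone do not suffice for `∃r.{a}`: the successors in `ã` vary with the
  -- coordinate and need not form the generic tuple.
  role r f g := (∀ z, I.role r (f z) (g z)) ∨
    ∃ a, g = generic (hI a) ∧ ∀ z, ∃ w, I.role r (f z) w ∧ w ∈ I.dnom a
  ind a := generic (hI a)
  dnom a := {f | ∀ z, f z ∈ I.dnom a}

theorem Concept.IsELDefeasible.eq_dnom {C : Concept CN RN ON} (hC : C.IsELDefeasible) {a : ON}
    (h : C.toNom = .nom a) : C = .dnom a := by
  cases C <;> simp_all [Concept.toNom, Concept.IsELDefeasible]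

/-- Membership in safe concepts is determined coordinatewise. -/
theorem Interp.mem_ext_genericPower (I : Interp CN RN ON) (hI : ∀ a, (I.dnom a).Nonempty)
    {C : Concept CN RN ON} (hC : C.IsELDefeasible) (hs : C.toNom.Safe) (f : I.dom → I.dom) :
    f ∈ (I.genericPower hI).ext C.toNom ↔ ∀ z, f z ∈ I.ext C := by
  induction C generalizing f with
  | atom => rfl
  | top => exact ⟨fun _ _ => trivial, fun _ => trivial⟩
  | bot => exact ⟨fun h => h.elim, fun h => (h I.dom_nonempty.some).elim⟩
  | dnom => exact hs.elim
  | nom => exact hC.elim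
  | neg => exact hC.elim
  | inf C D ihC ihD =>
    exact (and_congr (ihC hC.1 hs.1 f) (ihD hC.2 hs.2 f)).trans forall_and.symm
  | ex r C ih =>
    rcases hs with ⟨a, ha⟩ | hs
    · obtain rfl := Concept.IsELDefeasible.eq_dnom (C := C) hC ha
      constructor
      · rintro ⟨g, hg, rfl : g = generic (hI a)⟩ z
        rcases hg with hg | ⟨b, hb, hg⟩
        · exact ⟨_, hg z, generic_mem (hI a) z⟩
        · obtain ⟨w, hw, hwb⟩ := hg z
          refine ⟨w, hw, ?_⟩
          -- The tuples of `a` and `b` coincide; `w` is the entry of `b`'s tuple at coordinate `w`,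
          -- hence an entry of `a`'s tuple.
          rw [← generic_of_mem (hI b) hwb, ← hb]
          exact generic_mem (hI a) w
      · exact fun h => ⟨generic (hI a), .inr ⟨a, rfl, h⟩, rfl⟩
    · constructor
      · rintro ⟨g, hg, hgC⟩ z
        have hgC := (ih hC hs g).1 hgC
        rcases hg with hg | ⟨b, rfl, hg⟩
        · exact ⟨_, hg z, hgC z⟩
        · obtain ⟨w, hw, hwb⟩ := hg z
          exact ⟨w, hw, generic_of_mem (hI b) hwb ▸ hgC w⟩
      · intro h
        choose g hg hgC using h
        exact ⟨g, .inl hg, (ih hC hs g).2 hgC⟩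

/-- Constant tuples reflect an inclusion with safe left side; if the left side is a nominal, the
entries of the generic tuple are exactly the instances of `ã`. -/
theorem Interp.satGCI_genericPower_iff (I : Interp CN RN ON) (hI : ∀ a, (I.dnom a).Nonempty)
    {α : GCI CN RN ON} (hα : α.IsSafeDefeasible) :
    (I.genericPower hI).SatGCI α.toNom ↔ I.SatGCI α := by
  obtain ⟨hl, hr, hls, hrs⟩ := hα
  have hr := I.mem_ext_genericPower hI hr hrs
  rcases hls with hls | ⟨a, ha⟩
  · have hl := I.mem_ext_genericPower hI hl hls
    constructor
    · intro h x hx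
      exact (hr fun _ => x).1 (h ((hl fun _ => x).2 fun _ => hx)) x
    · intro h f hf
      exact (hr f).2 fun z => h ((hl f).1 hf z)
  · have hd := hl.eq_dnom ha
    unfold Interp.SatGCI GCI.toNom
    simp only [hd]
    constructor
    · intro h x hx
      exact generic_of_mem (hI a) hx ▸ (hr _).1 (h rfl) x
    · rintro h f (rfl : f = generic (hI a))
      exact (hr _).2 fun z => h (generic_mem (hI a) z)

/-- A tuple is ranked by the supremum of its entries' ranks. A minimal tuple of a safe antecedent is
compared with the constant tuple at a minimal instance, which forces every entry to be minimal. -/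
theorem Interp.exists_isModel_genericPower (I : Interp CN RN ON) (hI : ∀ a, (I.dnom a).Nonempty)
    {L : KB CN RN ON} (hL : L.IsNominalSafe) (hs : ∀ δ ∈ L.dbox, δ.lhs.toNom.Safe)
    {rk : I.dom → ℕ} (hM : (I.withRank rk).IsModel L) :
    ∃ rk', ((I.genericPower hI).withRank rk').IsModel L.toNom := by
  have hb : ∀ δ : DGCI CN RN ON, ∃ n, ∀ x ∈ (I.withRank rk).minimals (I.ext δ.lhs), rk x < n := by
    intro δ
    rcases ((I.withRank rk).minimals (I.ext δ.lhs)).eq_empty_or_nonempty with h | ⟨x, hx⟩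
    · exact ⟨0, by simp [h]⟩
    · refine ⟨rk x + 1, fun y hy => ?_⟩
      have := (Interp.mem_minimals_withRank.1 hy).2 x hx.1
      omega
  choose b hb using hb
  obtain ⟨N, hN⟩ := (hL.dbox_finite.image b).bddAbove
  -- Truncating at `N` keeps the supremum finite; as `N` exceeds the minimal rank of every
  -- antecedent, no relevant comparison is lost.
  let rk' : (I.dom → I.dom) → ℕ := fun f => ⨆ z, min (rk (f z)) N
  have hle : ∀ f z, min (rk (f z)) N ≤ rk' f := fun f z =>
    le_ciSup (f := fun z => min (rk (f z)) N) ⟨N, by rintro _ ⟨z, rfl⟩; exact min_le_right _ _⟩ z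
  refine ⟨rk', ?_, ?_⟩
  · rintro _ ⟨α, hα, rfl⟩
    exact (I.satGCI_genericPower_iff hI (hL.tbox_safe α hα)).2 (hM.1 α hα)
  · rintro _ ⟨δ, hδ, rfl⟩ f hf
    obtain ⟨hl, hr, -, hrs⟩ := hL.dbox_safe δ hδ
    have hl := I.mem_ext_genericPower hI hl (hs δ hδ)
    have hr := I.mem_ext_genericPower hI hr hrs
    obtain ⟨hfE, hfmin⟩ := Interp.mem_minimals_withRank.1 hf
    replace hfE := (hl f).1 hfE
    obtain ⟨m, hm, hmin⟩ := exists_minimalFor_of_wellFoundedLT (· ∈ I.ext δ.lhs) rk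
      ⟨_, hfE I.dom_nonempty.some⟩
    have hmin' : ∀ z ∈ I.ext δ.lhs, rk m ≤ rk z := fun z hz =>
      (le_total (rk m) (rk z)).elim id (hmin hz)
    have hmN : rk m < N := (hb δ m (Interp.mem_minimals_withRank.2 ⟨hm, hmin'⟩)).trans_le
      (hN ⟨δ, hδ, rfl⟩)
    have hc : rk' (fun _ => m) ≤ rk m :=
      haveI := I.dom_nonempty
      ciSup_le fun _ => min_le_left _ _
    have hfm := hfmin (fun _ => m) ((hl _).2 fun _ => hm)
    refine (hr f).2 fun z => hM.2 δ hδ (Interp.mem_minimals_withRank.2 ⟨hfE z, fun y hy => ?_⟩)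
    have h1 := hle f z
    have h2 := hmin' y hy
    have h3 : rk' f ≤ rk' fun _ => m := hfm
    have h4 : min (rk (f z)) N ≤ rk m := h1.trans (h3.trans hc)
    rw [min_le_iff] at h4
    omega

/-- A ranked model with defeasible nominals can be turned into one with classical nominals that
satisfies no further safe inclusion. -/
theorem KB.IsNominalSafe.exists_isModel_toNom {L : KB CN RN ON} (hL : L.IsNominalSafe)
    (hs : ∀ δ ∈ L.dbox, δ.lhs.toNom.Safe) (hsat : L.toNom.RankSatisfiable)
    {R : RankedInterp CN RN ON} (hR : R.IsModel L) :
    ∃ J : RankedInterp CN RN ON, J.IsModel L.toNom ∧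
      ∀ α : GCI CN RN ON, α.IsSafeDefeasible → J.SatGCI α.toNom → R.SatGCI α := by
  obtain ⟨R₀, hR₀⟩ := hsat
  replace hR₀ := hR₀.dnomSingleton
  have hne : ∀ a, (R₀.dnomSingleton.dnom a).Nonempty := fun a => ⟨_, rfl⟩
  generalize R₀.dnomSingleton = S at hR₀ hne
  obtain ⟨rk, hrk⟩ := R.eq_withRank
  generalize R.toInterp = I at rk hrk
  subst hrk
  obtain ⟨rk₀, hrk₀⟩ := S.eq_withRank
  generalize S.toInterp = I₀ at rk₀ hrk₀
  subst hrk₀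
  -- The second summand supplies an instance of each `ã`, even where it is empty in `I`.
  have hne' : ∀ a, ((I.sum I₀).dnom a).Nonempty := fun a => ⟨.inr (hne a).some, (hne a).some_mem⟩
  obtain ⟨rk', h'⟩ := (I.sum I₀).exists_isModel_genericPower hne' hL hs
    (hL.nomFree.isModel_sum hR hR₀)
  refine ⟨_, h', fun α hα h x hx => ?_⟩
  have := ((I.sum I₀).satGCI_genericPower_iff hne' hα).1 h
  exact ((I.mem_ext_sum I₀ hα.2.1.nomFree).1 x).1
    (this (((I.mem_ext_sum I₀ hα.1.nomFree).1 x).2 hx))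

theorem KB.IsNominalSafe.inRCStrict_of_entails {K : KB CN RN ON} (hK : K.IsNominalSafe)
    (hsat : K.toNom.RankSatisfiable) {α : GCI CN RN ON} (hα : α.IsSafeDefeasible)
    (h : Entails (K.toNom.tbox ∪ K.toNom.infiniteStrict) α.toNom) : K.InRCStrict α := by
  obtain ⟨n, hn⟩ := K.toNom.exists_stage_dbox_eq (hK.dbox_finite.image _)
  let L : KB CN RN ON := ⟨K.tbox, {δ | δ ∈ K.dbox ∧ K.toNom.rankAxiom δ.toNom = ⊤}⟩
  have hLt : L.toNom.tbox = K.toNom.tbox := rfl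
  have hLd : L.toNom.dbox = {δ | δ ∈ K.toNom.dbox ∧ K.toNom.rankAxiom δ = ⊤} := by
    ext δ'
    constructor
    · rintro ⟨δ, ⟨hδ, h⟩, rfl⟩
      exact ⟨⟨δ, hδ, rfl⟩, h⟩
    · rintro ⟨⟨δ, hδ, rfl⟩, h⟩
      exact ⟨δ, ⟨hδ, h⟩, rfl⟩
  have hLn : L.toNom = K.toNom.stage n := by
    rw [← hn] at hLd
    rw [← K.toNom.stage_tbox n] at hLt
    exact congrArg₂ KB.mk hLt hLd
  have hLs : L.IsNominalSafe := ⟨hK.tbox_finite, hK.dbox_finite.subset fun _ h => h.1,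
    hK.tbox_safe, fun δ hδ => hK.dbox_safe δ hδ.1⟩
  have hempty : ∀ J : RankedInterp CN RN ON, J.IsModel L.toNom → ∀ δ ∈ L.dbox,
      J.ext δ.lhs.toNom = ∅ := by
    intro J hJ δ hδ
    refine hJ.ext_lhs_eq_empty (δ := δ.toNom) (fun ε hε => ?_) ⟨δ, hδ, rfl⟩
    rw [hLd] at hε
    rw [hLn]
    exact (K.toNom.rank_eq_top_iff _).1 hε.2 n
  have hLsat : L.toNom.RankSatisfiable := by
    obtain ⟨R, hR⟩ := hsat
    exact ⟨R, hLn ▸ hR.stage n⟩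
  -- An antecedent in `L.toNom` is empty in a model that exists, so it cannot be a nominal.
  have hLsafe : ∀ δ ∈ L.dbox, δ.lhs.toNom.Safe := by
    intro δ hδ
    refine (hK.dbox_safe δ hδ.1).2.2.1.resolve_right ?_
    rintro ⟨a, ha⟩
    obtain ⟨R, hR⟩ := hLsat
    have := hempty R hR δ hδ
    rw [ha] at this
    exact Set.singleton_ne_empty _ this
  have hLK : ∀ i, L.dbox ⊆ (K.stage i).dbox := by
    intro i
    induction i with
    | zero => exact fun δ hδ => hδ.1
    | succ i ih =>
      refine fun δ hδ => ⟨ih hδ, fun R hR => ?_⟩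
      obtain ⟨J, hJ, hJR⟩ := hLs.exists_isModel_toNom hLsafe hLsat
        (hR.mono (K.stage_tbox i).ge ih)
      have hδs := hK.dbox_safe δ hδ.1
      -- Emptiness of the antecedent is itself a safe inclusion, so it is reflected from `J` to `R`.
      have := hJR ⟨δ.lhs, .bot⟩ ⟨hδs.1, trivial, hδs.2.2.1, trivial⟩ (hempty J hJ δ hδ).le
      rw [Set.subset_empty_iff.1 this, Set.empty_inter]
  rw [KB.inRCStrict_iff]
  intro i R hR
  obtain ⟨J, hJ, hJR⟩ := hLs.exists_isModel_toNom hLsafe hLsat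
    (hR.mono (K.stage_tbox i).ge (hLK i))
  have hsub := hJR α hα <| h _ <| by
    rintro β (hβ | ⟨δ, hδ, hδr, rfl⟩)
    · exact hJ.1 β hβ
    · obtain ⟨ε, hε, rfl⟩ := hδ
      intro x hx
      exact ((hempty J hJ ε ⟨hε, hδr⟩).le hx).elim
  exact Set.eq_empty_iff_forall_notMem.2 fun x hx => hx.1.2 (hsub hx.1.1)

/-- Every concept is vacuously exceptional, so no axiom is ever dropped and all stages equal `K`. -/
theorem KB.inRCStrict_of_not_rankSatisfiable {K : KB CN RN ON} (hK : ¬ K.RankSatisfiable)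
    (α : GCI CN RN ON) : K.InRCStrict α := by
  have h : ∀ C, K.Exceptional C := fun C R hR => (hK ⟨R, hR⟩).elim
  have hs : ∀ i, K.stage i = K := by
    intro i
    induction i with
    | zero => rfl
    | succ i ih =>
      unfold KB.stage
      rw [ih]
      exact congrArg (KB.mk K.tbox) (Set.ext fun δ => and_iff_left (h _))
  rw [KB.inRCStrict_iff]
  exact fun i => (hs i).symm ▸ h _

end RCNominals

theorem mainTheorem4 {CN RN ON : Type u} (K : RCNominals.KB CN RN ON) (hK : K.IsNominalSafe)
    (α : RCNominals.GCI CN RN ON) (hα : α.IsSafeDefeasible) :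
    (K.InRCStrict α ↔ K.toNom.N.InRCStrict α.toNom.N) ∧
    (K.InRCStrict α →
      RCNominals.Entails (K.toNom.tbox ∪ K.toNom.infiniteStrict) α.toNom) ∧
    ((K.RankSatisfiable → K.toNom.RankSatisfiable) →
      List.TFAE
        [K.InRCStrict α,
         K.toNom.N.InRCStrict α.toNom.N,
         RCNominals.Entails (K.toNom.tbox ∪ K.toNom.infiniteStrict) α.toNom]) := by
  have h12 := (hK.nomFree.inRCStrict_toNom_N_iff hα.1.nomFree hα.2.1.nomFree).symm
  have h13 : K.InRCStrict α →
      RCNominals.Entails (K.toNom.tbox ∪ K.toNom.infiniteStrict) α.toNom :=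
    fun h => RCNominals.KB.entails_of_inRCStrict (hK.dbox_finite.image _) h.toNom
  refine ⟨h12, h13, fun hsat => ?_⟩
  have h31 : RCNominals.Entails (K.toNom.tbox ∪ K.toNom.infiniteStrict) α.toNom →
      K.InRCStrict α := by
    intro h
    by_cases hKs : K.RankSatisfiable
    · exact hK.inRCStrict_of_entails (hsat hKs) hα h
    · exact RCNominals.KB.inRCStrict_of_not_rankSatisfiable hKs α
  tfae_have 1 ↔ 2 := h12
  tfae_have 1 → 3 := h13
  tfae_have 3 → 1 := h31
  tfae_finish
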